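/- For a group $G$ let $\operatorname{var} G$ be the variety of groups generated by $G$, that is, the class of all groups satisfying every identity (law) of $G$. For varieties $\mathfrak U,\mathfrak V$ let $\mathfrak U\cdot\mathfrak V$ be the class of all groups $G$ that have a normal subgroup $N$ with $N\in\mathfrak U$ and $G/N\in\mathfrak V$. For groups $A$ and $B$ let $A\operatorname{Wr}B$ be their cartesian wreath product, the semidirect product $A^{B}\rtimes B$ in which $B$ acts on the group $A^{B}$ of all functions $B\to A$ by translation of the argument, and let $A\operatorname{wr}B$ be their direct wreath product, the subgroup $A^{(B)}\rtimes B$, where $A^{(B)}\le A^{B}$ consists of the functions of finite support. \textbf{Theorem.} Let $A$ and $B$ be abelian groups at least one of which is not of finite exponent (a group $G$ is of finite exponent if there is an integer $n\ge 1$ with $g^{n}=1$ for all $g\in G$). Then $$\operatorname{var}(A\operatorname{Wr}B)=\operatorname{var}A\cdot\operatorname{var}B\qquad\text{and}\qquad \operatorname{var}(A\operatorname{wr}B)=\operatorname{var}A\cdot\operatorname{var}B .$$ -/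

import Mathlib

universe u v w

/-- The word `r`, in countably many variables, is a law (identity) of the group `G`: every
substitution of elements of `G` for the variables turns `r` into `1`. -/
def IsGroupLaw (G : Type u) [Group G] (r : FreeGroup ℕ) : Prop :=
  ∀ φ : FreeGroup ℕ →* G, φ r = 1

/-- A class of groups is a variety if it consists of all groups satisfying some set of laws. -/
def IsGroupVariety (C : Set GrpCat.{w}) : Prop :=
  ∃ R : Set (FreeGroup ℕ), C = {H : GrpCat.{w} | ∀ r ∈ R, IsGroupLaw H r}

/-- The variety `var G` generated by the group `G`: all groups (in the universe `w`) that satisfy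
every law of `G`. -/
def groupVar (G : Type u) [Group G] : Set GrpCat.{w} :=
  {H : GrpCat.{w} | ∀ r : FreeGroup ℕ, IsGroupLaw G r → IsGroupLaw H r}

/-- `var G` is the smallest variety containing `G`. -/
theorem isLeast_groupVar (G : Type u) [Group G] :
    IsLeast {C : Set GrpCat.{u} | IsGroupVariety C ∧ GrpCat.of G ∈ C} (groupVar.{u, u} G) := by
  refine ⟨⟨⟨{r | IsGroupLaw G r}, rfl⟩, fun _ h => h⟩, ?_⟩
  rintro _ ⟨⟨R, rfl⟩, hG⟩ H hH r hr
  exact hH r (hG r hr)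

/-- The product `U · V` of two classes of groups: all extensions of a group in `U` (the normal
subgroup) by a group in `V` (the quotient). -/
def varietyProduct (U V : Set GrpCat.{w}) : Set GrpCat.{w} :=
  {G : GrpCat.{w} | ∃ (N : Subgroup G) (_ : N.Normal), GrpCat.of N ∈ U ∧ GrpCat.of (G ⧸ N) ∈ V}

/-- The direct (restricted) wreath product of `A` and `B`: the subgroup of the cartesian
(unrestricted) regular wreath product `A ≀ᵣ B`, whose base group is the group of all functions
`B → A`, consisting of the elements whose base component has finite support. -/
def directWreath (A : Type u) (B : Type v) [Group A] [Group B] : Subgroup (A ≀ᵣ B) where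
  carrier := {x | (Function.mulSupport x.left).Finite}
  one_mem' := by simp
  mul_mem' := by
    intro x y hx hy
    refine (hx.union (hy.image (fun b => x.right * b))).subset ?_
    intro b hb
    by_contra hcon
    simp only [Set.mem_union, Function.mem_mulSupport, Set.mem_image, not_or, not_not,
      not_exists, not_and] at hcon
    apply hb
    have h2 : y.left (x.right⁻¹ * b) = 1 := by
      by_contra h
      exact hcon.2 _ h (by simp)
    simp [hcon.1, h2]
  inv_mem' := by
    intro x hx
    refine (hx.image (fun b => x.right⁻¹ * b)).subset ?_
    intro b hb
    refine ⟨x.right * b, ?_, by simp⟩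
    simpa using hb

/-! Let `m`, `n` be the exponents of `A`, `B`, with `0` for infinite exponent. As `A wr B ≤ A Wr B`,
two inclusions suffice. In `A Wr B`, values of laws of `B` lie in the base group, so they commute
and have trivial `m`-th powers. These are laws, hence in each `H` in `var (A Wr B)` the values of
laws of `B` generate a normal subgroup in `var A` (`groupVar_wreath_subset`). Conversely, an
extension of `N` by `Q` embeds in `N Wr Q`, where the value of a word depends only on its Fox
derivatives over `ℤ[P]`, `P` free abelian of exponent `n`, and its image in `P`. For a law of `A wr
B`, all images of the derivatives in `ℤ[B]` are divisible by `m`. Infinite exponent of `A` or `B`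
lifts this to `ℤ[P]` (`exponent_dvd_magnus`), so the law holds in `N Wr Q`. -/

open Multiplicative
open scoped commutatorElement

/-! ### Transfer of laws along homomorphisms -/

section Laws

variable {G : Type u} {H : Type v} [Group G] [Group H]

theorem IsGroupLaw.of_injective {r : FreeGroup ℕ} (h : IsGroupLaw H r) (f : G →* H)
    (hf : Function.Injective f) : IsGroupLaw G r := fun φ =>
  hf (by simpa using h (f.comp φ))

theorem IsGroupLaw.of_surjective {r : FreeGroup ℕ} (h : IsGroupLaw G r) (f : G →* H)
    (hf : Function.Surjective f) : IsGroupLaw H r := fun φ => by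
  have : φ = f.comp (FreeGroup.lift fun i => Function.surjInv hf (φ (FreeGroup.of i))) := by
    ext i
    simp [Function.surjInv_eq hf]
  rw [this, MonoidHom.comp_apply, h, map_one]

theorem IsGroupLaw.map {r : FreeGroup ℕ} (h : IsGroupLaw G r) (f : ℕ → ℕ) :
    IsGroupLaw G (FreeGroup.map f r) := fun φ => h (φ.comp (FreeGroup.map f))

end Laws

/-! ### Laws of abelian groups -/

/-- The free abelian group of exponent dividing `n` on countably many generators. -/
abbrev FreeExpAb (n : ℕ) : Type := Multiplicative (ℕ →₀ ZMod n)

/-- The standard generators of `FreeExpAb n`. -/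
noncomputable def FreeExpAb.gen (n : ℕ) (i : ℕ) : FreeExpAb n := ofAdd (Finsupp.single i 1)

/-- The canonical projection from the free group. -/
noncomputable def FreeExpAb.proj (n : ℕ) : FreeGroup ℕ →* FreeExpAb n := FreeGroup.lift (FreeExpAb.gen n)

theorem FreeExpAb.exists_hom {n : ℕ} {Q : Type u} [CommGroup Q] (hQ : ∀ q : Q, q ^ n = 1)
    (q : ℕ → Q) : ∃ θ : FreeExpAb n →* Q, ∀ i, θ (FreeExpAb.gen n i) = q i := by
  let : Module (ZMod n) (Additive Q) := AddCommGroup.zmodModule hQ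
  refine ⟨AddMonoidHom.toMultiplicativeLeft
    (Finsupp.linearCombination (ZMod n) fun i => Additive.ofMul (q i)).toAddMonoidHom, fun i => ?_⟩
  simp [FreeExpAb.gen]

theorem isGroupLaw_of_exponent {B : Type u} [CommGroup B] {n : ℕ} (hB : ∀ b : B, b ^ n = 1)
    {r : FreeGroup ℕ} (hr : FreeExpAb.proj n r = 1) : IsGroupLaw B r := fun φ => by
  obtain ⟨θ, hθ⟩ := FreeExpAb.exists_hom hB fun i => φ (FreeGroup.of i)
  have : φ = θ.comp (FreeExpAb.proj n) := by
    ext i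
    simp [FreeExpAb.proj, hθ]
  rw [this, MonoidHom.comp_apply, hr, map_one]

theorem exponent_dvd_int {B : Type u} [Group B] {k : ℤ} (h : ∀ b : B, b ^ k = 1) :
    (Monoid.exponent B : ℤ) ∣ k := by
  rw [Int.natCast_dvd, Monoid.exponent_dvd_iff_forall_pow_eq_one]
  intro g
  have := h g
  rcases Int.natAbs_eq k with hk | hk <;> rw [hk] at this <;> simpa using this

/-- Putting `b` for the `j`-th variable and `1` for the others gives `b` to the `j`-th exponent sum.
Infinite exponent is covered by `ZMod 0 = ℤ`. -/
theorem IsGroupLaw.proj_eq_one {B : Type u} [CommGroup B] {r : FreeGroup ℕ}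
    (hr : IsGroupLaw B r) : FreeExpAb.proj (Monoid.exponent B) r = 1 := by
  let : Module (ZMod (Monoid.exponent B)) (Additive B) :=
    AddCommGroup.zmodModule (n := Monoid.exponent B) fun b : Additive B =>
      Monoid.pow_exponent_eq_one b.toMul
  set p := FreeExpAb.proj (Monoid.exponent B) r with hp
  suffices p.toAdd = 0 from toAdd_eq_zero.1 this
  ext j
  have key : ∀ b : B, p.toAdd j • Additive.ofMul b = 0 := fun b => by
    have := hr ((AddMonoidHom.toMultiplicativeLeft (α := ℕ →₀ ZMod (Monoid.exponent B))
      ((LinearMap.toSpanSingleton (ZMod (Monoid.exponent B)) (Additive B) (Additive.ofMul b)).comp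
        (Finsupp.lapply j)).toAddMonoidHom).comp (FreeExpAb.proj (Monoid.exponent B)))
    exact congrArg Additive.ofMul this
  obtain ⟨k, hk⟩ := ZMod.intCast_surjective (p.toAdd j)
  simp_rw [← hk, Int.cast_smul_eq_zsmul] at key
  rw [← hk, Finsupp.coe_zero, Pi.zero_apply, ZMod.intCast_zmod_eq_zero_iff_dvd]
  exact exponent_dvd_int fun b => Additive.ofMul.injective (key b)

theorem isGroupLaw_of_exponent_dvd {B : Type u} {H : Type v} [CommGroup B] [CommGroup H]
    (hH : ∀ x : H, x ^ Monoid.exponent B = 1) {r : FreeGroup ℕ} (hr : IsGroupLaw B r) :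
    IsGroupLaw H r :=
  isGroupLaw_of_exponent hH hr.proj_eq_one

section Groupvar

variable {B : Type u} [CommGroup B] {H : GrpCat.{w}}

theorem mul_comm_of_mem_groupVar (h : H ∈ groupVar B) (x y : H) : x * y = y * x := by
  have := h ⁅FreeGroup.of 0, FreeGroup.of 1⁆ (fun φ => by
    rw [map_commutatorElement, commutatorElement_eq_one_iff_mul_comm, mul_comm])
    (FreeGroup.lift fun i => if i = 0 then x else y)
  rw [map_commutatorElement, commutatorElement_eq_one_iff_mul_comm] at this
  simpa using this

theorem pow_eq_one_of_mem_groupVar (h : H ∈ groupVar B) (x : H) :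
    x ^ Monoid.exponent B = 1 := by
  have := h (FreeGroup.of 0 ^ Monoid.exponent B) (fun φ => by
    rw [map_pow, Monoid.pow_exponent_eq_one]) (FreeGroup.lift fun _ => x)
  simpa using this

end Groupvar

/-! ### The subgroup generated by the values of laws of `B` -/

section Wreath

variable {A : Type u} {B : Type v} [CommGroup A] [CommGroup B] {H : Type w} [Group H]

theorem right_eq_one_of_isGroupLaw {r : FreeGroup ℕ} (hr : IsGroupLaw B r)
    (φ : FreeGroup ℕ →* A ≀ᵣ B) : (φ r).right = 1 :=
  hr (RegularWreathProduct.rightHom.comp φ)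

theorem isGroupLaw_commutator_wreath {r s : FreeGroup ℕ} (hr : IsGroupLaw B r)
    (hs : IsGroupLaw B s) : IsGroupLaw (A ≀ᵣ B) ⁅r, s⁆ := fun φ => by
  have h1 := right_eq_one_of_isGroupLaw hr φ
  have h2 := right_eq_one_of_isGroupLaw hs φ
  rw [map_commutatorElement, commutatorElement_eq_one_iff_mul_comm]
  ext b
  · simp [h1, h2, mul_comm]
  · simp [h1, h2]

theorem isGroupLaw_pow_wreath {r : FreeGroup ℕ} (hr : IsGroupLaw B r) :
    IsGroupLaw (A ≀ᵣ B) (r ^ Monoid.exponent A) := fun φ => by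
  have h1 := right_eq_one_of_isGroupLaw hr φ
  have key : ∀ k : ℕ, (φ r ^ k).left = (φ r).left ^ k ∧ (φ r ^ k).right = 1 := by
    intro k
    induction k with
    | zero => simp
    | succ k ih =>
      refine ⟨?_, by simp [pow_succ, ih.2, h1]⟩
      ext b
      simp [pow_succ, ih.1, ih.2]
  rw [map_pow]
  ext b
  · simp [(key _).1, Monoid.pow_exponent_eq_one]
  · simp [(key _).2]

variable (B H) in
/-- The values in `H` of the laws of `B`. -/
def lawValues : Set H := {x | ∃ (φ : FreeGroup ℕ →* H) (r : FreeGroup ℕ), IsGroupLaw B r ∧ φ r = x}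

/-- Even variables carry one substitution and odd ones the other, so that the law `⁅r, s⁆` applies
to any two values. -/
theorem exists_merge {x y : H} (hx : x ∈ lawValues B H) (hy : y ∈ lawValues B H) :
    ∃ (φ : FreeGroup ℕ →* H) (r s : FreeGroup ℕ), IsGroupLaw B r ∧ IsGroupLaw B s ∧
      φ r = x ∧ φ s = y := by
  obtain ⟨φ, r, hr, rfl⟩ := hx
  obtain ⟨ψ, s, hs, rfl⟩ := hy
  let χ : FreeGroup ℕ →* H := FreeGroup.lift fun i =>
    if Even i then φ (FreeGroup.of (i / 2)) else ψ (FreeGroup.of (i / 2))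
  refine ⟨χ, _, _, hr.map fun i => 2 * i, hs.map fun i => 2 * i + 1, ?_, ?_⟩
  · refine DFunLike.congr_fun (f := χ.comp (FreeGroup.map fun i => 2 * i)) (g := φ) ?_ r
    ext i
    simp [χ]
  · refine DFunLike.congr_fun (f := χ.comp (FreeGroup.map fun i => 2 * i + 1)) (g := ψ) ?_ s
    ext i
    have : (2 * i + 1) / 2 = i := by omega
    simp [χ, this]

theorem lawValues_closure_normal : (Subgroup.closure (lawValues B H)).Normal := by
  refine ⟨fun x hx g => ?_⟩
  induction hx using Subgroup.closure_induction with
  | mem x hx =>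
    obtain ⟨φ, r, hr, rfl⟩ := hx
    exact Subgroup.subset_closure ⟨(MulAut.conj g).toMonoidHom.comp φ, r, hr, rfl⟩
  | one => simp
  | mul x y _ _ hx hy => simpa using mul_mem hx hy
  | inv x _ hx => simpa [mul_assoc] using inv_mem hx

theorem groupVar_wreath_subset :
    groupVar.{max u v, w} (A ≀ᵣ B) ⊆
      varietyProduct (groupVar.{u, w} A) (groupVar.{v, w} B) := by
  intro H hH
  have hcomm : ∀ x ∈ lawValues B H, ∀ y ∈ lawValues B H, x * y = y * x := by
    intro x hx y hy
    obtain ⟨φ, r, s, hr, hs, rfl, rfl⟩ := exists_merge hx hy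
    have := hH _ (isGroupLaw_commutator_wreath hr hs) φ
    rwa [map_commutatorElement, commutatorElement_eq_one_iff_mul_comm] at this
  have hmul := Subgroup.isMulCommutative_closure hcomm
  let : CommGroup (Subgroup.closure (lawValues B H)) :=
    { (inferInstance : Group (Subgroup.closure (lawValues B H))) with
      mul_comm := hmul.is_comm.comm }
  refine ⟨Subgroup.closure (lawValues B H), lawValues_closure_normal, ?_, ?_⟩
  · intro r hr
    refine isGroupLaw_of_exponent_dvd (H := Subgroup.closure (lawValues B H)) ?_ hr
    rintro ⟨x, hx⟩
    have aux : ∀ x (hx : x ∈ Subgroup.closure (lawValues B H)),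
        (⟨x, hx⟩ : Subgroup.closure (lawValues B H)) ^ Monoid.exponent A = 1 := by
      intro x hx
      induction hx using Subgroup.closure_induction with
      | mem x hx =>
        obtain ⟨φ, r, hr, rfl⟩ := hx
        have := hH _ (isGroupLaw_pow_wreath hr) φ
        exact Subtype.ext (by simpa using this)
      | one => exact one_pow _
      | mul x y hx hy ihx ihy =>
        have := mul_pow (⟨x, hx⟩ : Subgroup.closure (lawValues B H)) ⟨y, hy⟩ (Monoid.exponent A)
        rw [ihx, ihy, one_mul] at this
        exact this
      | inv x hx ih =>
        have := inv_pow (⟨x, hx⟩ : Subgroup.closure (lawValues B H)) (Monoid.exponent A)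
        rw [ih, inv_one] at this
        exact this
    exact aux x hx
  · intro r hr φ
    have := lawValues_closure_normal (B := B) (H := H)
    let χ : FreeGroup ℕ →* H := FreeGroup.lift fun i => (φ (FreeGroup.of i)).out
    have : φ = (QuotientGroup.mk' (Subgroup.closure (lawValues B H))).comp χ := by
      ext i
      simp [χ]
    rw [this]
    exact (QuotientGroup.eq_one_iff _).2 (Subgroup.subset_closure ⟨χ, r, hr, rfl⟩)

end Wreath

/-! ### Fox derivatives and wreath products -/

section Fox

/-- Pairs of a family of elements of the integral group ring of `P`, indexed by the variables, and
an element of `P`. -/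
@[ext]
structure FoxPair (P : Type u) where
  /-- The coefficients. -/
  left : ℕ →₀ P →₀ ℤ
  /-- The group component. -/
  right : P

namespace FoxPair

variable {P : Type u} [Group P]

/-- Left translation of a family of elements of the integral group ring. -/
noncomputable def translate (g : P) : (ℕ →₀ P →₀ ℤ) →+ (ℕ →₀ P →₀ ℤ) :=
  Finsupp.mapRange.addMonoidHom (Finsupp.mapDomain.addMonoidHom (g * ·))

@[simp]
theorem translate_single (g p : P) (i : ℕ) (z : ℤ) :
    translate g (Finsupp.single i (Finsupp.single p z)) =
      Finsupp.single i (Finsupp.single (g * p) z) := by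
  simp [translate]

theorem translate_one : translate (1 : P) = AddMonoidHom.id _ := by
  ext i p : 4
  simp

theorem translate_mul (g h : P) : translate (g * h) = (translate g).comp (translate h) := by
  ext i p : 4
  simp [mul_assoc]

/-- The semidirect product of the families with the group acting by translation. -/
noncomputable instance : Group (FoxPair P) where
  mul x y := ⟨x.left + translate x.right y.left, x.right * y.right⟩
  one := ⟨0, 1⟩
  inv x := ⟨-translate x.right⁻¹ x.left, x.right⁻¹⟩
  mul_assoc x y z := by
    refine FoxPair.ext ?_ (mul_assoc _ _ _)
    change x.left + translate x.right y.left + translate (x.right * y.right) z.left =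
      x.left + translate x.right (y.left + translate y.right z.left)
    simp [translate_mul, add_assoc]
  one_mul x := by
    refine FoxPair.ext ?_ (one_mul _)
    change 0 + translate 1 x.left = x.left
    simp [translate_one]
  mul_one x := by
    refine FoxPair.ext ?_ (mul_one _)
    change x.left + translate x.right 0 = x.left
    simp
  inv_mul_cancel x := by
    refine FoxPair.ext ?_ (inv_mul_cancel _)
    change -translate x.right⁻¹ x.left + translate x.right⁻¹ x.left = 0
    simp

theorem mul_left (x y : FoxPair P) : (x * y).left = x.left + translate x.right y.left := rfl

/-- The projection to the group component. -/
def rightHom : FoxPair P →* P where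
  toFun := right
  map_one' := rfl
  map_mul' _ _ := rfl

/-- The Magnus homomorphism: the left component of the image of a word consists of the images of
its Fox derivatives. -/
noncomputable def magnus (g : ℕ → P) : FreeGroup ℕ →* FoxPair P :=
  FreeGroup.lift fun i => ⟨Finsupp.single i (Finsupp.single 1 1), g i⟩

theorem magnus_right (g : ℕ → P) (r : FreeGroup ℕ) : (magnus g r).right = FreeGroup.lift g r := by
  refine DFunLike.congr_fun (f := rightHom.comp (magnus g)) ?_ r
  ext i
  simp [magnus, rightHom]

variable {A : Type v} {B : Type w} [CommGroup A] [Group B]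

/-- Evaluation of a family of group ring elements at the functions `f i`, at the point `b`. -/
noncomputable def eval (θ : P →* B) (f : ℕ → B → A) (b : B) : (ℕ →₀ P →₀ ℤ) →+ Additive A :=
  Finsupp.liftAddHom fun i => Finsupp.liftAddHom fun p =>
    (zmultiplesHom (Additive A)) (Additive.ofMul (f i ((θ p)⁻¹ * b)))

@[simp]
theorem eval_single (θ : P →* B) (f : ℕ → B → A) (b : B) (i : ℕ) (u : P →₀ ℤ) :
    eval θ f b (Finsupp.single i u) =
      u.sum fun p z => z • Additive.ofMul (f i ((θ p)⁻¹ * b)) := by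
  rw [eval, Finsupp.liftAddHom_apply_single, Finsupp.liftAddHom_apply]
  rfl

theorem eval_translate (θ : P →* B) (f : ℕ → B → A) (b : B) (g : P) (d : ℕ →₀ P →₀ ℤ) :
    eval θ f b (translate g d) = eval θ f ((θ g)⁻¹ * b) d := by
  refine DFunLike.congr_fun (f := (eval θ f b).comp (translate g)) ?_ d
  ext i p : 4
  simp [mul_assoc]

/-- The homomorphism to a wreath product that is given by the functions `f i`. -/
noncomputable def toWreath (θ : P →* B) (f : ℕ → B → A) : FoxPair P →* A ≀ᵣ B where
  toFun x := ⟨fun b => (eval θ f b x.left).toMul, θ x.right⟩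
  map_one' := by
    refine RegularWreathProduct.ext (funext fun b => ?_) (map_one θ)
    exact congrArg Additive.toMul (map_zero (eval θ f b))
  map_mul' x y := by
    refine RegularWreathProduct.ext (funext fun b => ?_) (map_mul θ _ _)
    simp [mul_left, eval_translate]

/-- Both sides agree on the generators. -/
theorem eq_toWreath_comp_magnus {g : ℕ → P} (φ : FreeGroup ℕ →* A ≀ᵣ B) (θ : P →* B)
    (h : ∀ i, θ (g i) = (φ (FreeGroup.of i)).right) :
    φ = (toWreath θ fun i => (φ (FreeGroup.of i)).left).comp (magnus g) := by
  ext i : 1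
  refine RegularWreathProduct.ext (funext fun b => ?_) ?_
  · simp [magnus, toWreath]
  · simp [magnus, toWreath, h]

theorem eval_eq_zero {m : ℕ} (hA : ∀ a : A, a ^ m = 1) (θ : P →* B) (f : ℕ → B → A) (b : B)
    {d : ℕ →₀ P →₀ ℤ} (hd : ∀ i p, (m : ℤ) ∣ d i p) : eval θ f b d = 0 := by
  simp only [eval, Finsupp.liftAddHom_apply, Finsupp.sum]
  refine Finset.sum_eq_zero fun i _ => Finset.sum_eq_zero fun p _ => ?_
  obtain ⟨k, hk⟩ := hd i p
  rw [hk, mul_comm]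
  change ((_ : A) ^ (k * (m : ℤ))) = 1
  rw [mul_comm, zpow_mul, zpow_natCast, hA, one_zpow]

open Classical in
theorem eval_mulSingle (θ : P →* B) (a : A) (j : ℕ) (b : B) (d : ℕ →₀ P →₀ ℤ) :
    eval θ (Pi.mulSingle j (Pi.mulSingle 1 a)) b d =
      (Finsupp.mapDomain θ (d j) b) • Additive.ofMul a := by
  induction d using Finsupp.induction_linear with
  | zero => simp
  | add d e hd he => rw [map_add, hd, he, Finsupp.add_apply, Finsupp.mapDomain_add,
      Finsupp.add_apply, add_smul]
  | single i u =>
    rw [eval_single]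
    rcases eq_or_ne i j with rfl | hij
    · induction u using Finsupp.induction_linear with
      | zero => simp
      | add u v hu hv =>
        rw [Finsupp.sum_add_index' (by simp) (fun _ _ _ => add_smul _ _ _), hu, hv]
        simp [Finsupp.mapDomain_add, add_smul]
      | single p z =>
        rcases eq_or_ne (θ p) b with rfl | hb
        · simp
        · have : (θ p)⁻¹ * b ≠ 1 := by rwa [Ne, inv_mul_eq_one]
          simp [hb, this]
    · simp [hij, Ne.symm hij]

end FoxPair

end Fox

/-! ### Laws of the direct wreath product -/

section Necessity

open FoxPair

variable {A : Type u} {B : Type v} [CommGroup A] [CommGroup B]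

/-- With the point mass `a` at `1` in variable `j` and trivial functions elsewhere, the value of `r`
at `b` is `a` to the coefficient in question. -/
theorem FoxPair.exponent_dvd_mapDomain {P : Type w} [Group P] {g : ℕ → P} {r : FreeGroup ℕ}
    (hr : IsGroupLaw (directWreath A B) r) (θ : P →* B) (j : ℕ) (b : B) :
    (Monoid.exponent A : ℤ) ∣ Finsupp.mapDomain θ ((magnus g r).left j) b := by
  classical
  refine exponent_dvd_int fun a => ?_
  let f : ℕ → B → A := Pi.mulSingle j (Pi.mulSingle 1 a)
  have hf (i : ℕ) : (Function.mulSupport (f i)).Finite := by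
    refine (Set.finite_singleton (1 : B)).subset fun b hb => ?_
    by_contra hb1
    rcases eq_or_ne i j with rfl | hij
    · exact hb (by simp [f, show b ≠ 1 from hb1])
    · exact hb (by simp [f, hij])
  let φ : FreeGroup ℕ →* directWreath A B := FreeGroup.lift fun i => ⟨⟨f i, θ (g i)⟩, hf i⟩
  have h1 := eq_toWreath_comp_magnus (g := g) ((directWreath A B).subtype.comp φ) θ
    (fun i => by simp [φ])
  have h2 : (fun i => (((directWreath A B).subtype.comp φ) (FreeGroup.of i)).left) = f := by
    ext i b
    simp [φ]
  rw [h2] at h1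
  have h3 := DFunLike.congr_fun h1 r
  rw [MonoidHom.comp_apply, hr φ, map_one] at h3
  have h4 := congrFun (congrArg RegularWreathProduct.left h3) b
  have h5 : eval θ f b (magnus g r).left = 0 := congrArg Additive.ofMul h4.symm
  rw [eval_mulSingle] at h5
  exact h5

theorem isGroupLaw_of_directWreath {r : FreeGroup ℕ} (hr : IsGroupLaw (directWreath A B) r) :
    IsGroupLaw B r := by
  refine hr.of_surjective (RegularWreathProduct.rightHom.comp (directWreath A B).subtype) fun b => ?_
  exact ⟨⟨⟨1, b⟩, by simp [directWreath]⟩, rfl⟩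

/-- Homomorphisms to a group of infinite exponent separate the elements of finite subsets of a free
abelian group. -/
theorem exists_hom_ne (hB : Monoid.exponent B = 0) (s : Finset (Multiplicative (ℕ →₀ ℤ)))
    (p : Multiplicative (ℕ →₀ ℤ)) (hp : p ∉ s) : ∃ θ : Multiplicative (ℕ →₀ ℤ) →* B, ∀ q ∈ s, θ q ≠ θ p := by
  -- Sending generator `i` to `b ^ (t ^ i)` sends `q` to `b ^ (pol q)(t)`.
  let pol (q : Multiplicative (ℕ →₀ ℤ)) : Polynomial ℤ :=
    ∑ i ∈ q.toAdd.support, Polynomial.monomial i (q.toAdd i)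
  have pol_coeff (q : Multiplicative (ℕ →₀ ℤ)) (i : ℕ) : (pol q).coeff i = q.toAdd i := by
    simp only [pol, Polynomial.finsetSum_coeff, Polynomial.coeff_monomial]
    simp +contextual [eq_comm]
  have hne : ∏ q ∈ s, (pol q - pol p) ≠ 0 := by
    refine Finset.prod_ne_zero_iff.2 fun q hq h0 => hp ?_
    have : q = p := toAdd.injective (Finsupp.ext fun i => by
      rw [← pol_coeff, ← pol_coeff, sub_eq_zero.1 h0])
    rwa [← this]
  obtain ⟨t, ht⟩ : ∃ t : ℤ, (∏ q ∈ s, (pol q - pol p)).eval t ≠ 0 := by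
    by_contra! h
    exact hne (Polynomial.funext fun t => by simpa using h t)
  -- One nonzero exponent, divisible by every difference, is enough; `B` may be torsion.
  obtain ⟨b, hb⟩ : ∃ b : B, b ^ (∏ q ∈ s, (pol q - pol p)).eval t ≠ 1 := by
    by_contra! h
    have := exponent_dvd_int h
    rw [hB] at this
    exact ht (by simpa using this)
  let θ : Multiplicative (ℕ →₀ ℤ) →* B := (zpowersHom B b).comp (AddMonoidHom.toMultiplicative
    (Finsupp.linearCombination ℤ fun i : ℕ => t ^ i).toAddMonoidHom)
  have hθ (q : Multiplicative (ℕ →₀ ℤ)) : θ q = b ^ (pol q).eval t := by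
    have : (pol q).eval t = Finsupp.linearCombination ℤ (fun i : ℕ => t ^ i) q.toAdd := by
      simp [pol, Polynomial.eval_finsetSum, Finsupp.linearCombination_apply, Finsupp.sum]
    rw [this]
    rfl
  refine ⟨θ, fun q hq h => hb ?_⟩
  rw [hθ, hθ, ← mul_inv_eq_one, ← zpow_neg, ← zpow_add, ← sub_eq_add_neg] at h
  rw [Polynomial.eval_prod, ← Finset.mul_prod_erase _ _ hq, zpow_mul, Polynomial.eval_sub, h,
    one_zpow]

open Classical in
theorem dvd_of_mapDomain_of_exponent_eq_zero {m : ℤ} (hB : Monoid.exponent B = 0)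
    {d : Multiplicative (ℕ →₀ ℤ) →₀ ℤ} (h : ∀ (θ : Multiplicative (ℕ →₀ ℤ) →* B) (b : B), m ∣ Finsupp.mapDomain θ d b)
    (p : Multiplicative (ℕ →₀ ℤ)) : m ∣ d p := by
  obtain ⟨θ, hθ⟩ := exists_hom_ne hB (d.support.erase p) p (by simp)
  have := h θ (θ p)
  rwa [Finsupp.mapDomain, Finsupp.sum_apply, Finsupp.sum, Finset.sum_eq_single p,
    Finsupp.single_eq_same] at this
  · intro q hq hqp
    exact Finsupp.single_eq_of_ne' (hθ q (Finset.mem_erase.2 ⟨hqp, hq⟩))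
  · intro hp
    simpa using hp

/-- Homomorphisms to a group of finite exponent `n` jointly separate the integral group ring of the
free abelian group of exponent `n`. -/
theorem eq_zero_of_mapDomain {n : ℕ} (hn : n ≠ 0) {B : Type v} [CommGroup B] {b : B}
    (hb : orderOf b = n) {d : FreeExpAb n →₀ ℤ}
    (h : ∀ θ : FreeExpAb n →* B, Finsupp.mapDomain θ d = 0) : d = 0 := by
  have : NeZero n := ⟨hn⟩
  let ι : ZMod n →+ Additive B := ZMod.lift n ⟨zmultiplesHom (Additive B) (Additive.ofMul b), by
    change b ^ (n : ℤ) = 1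
    rw [zpow_natCast, ← hb, pow_orderOf_eq_one]⟩
  have hι : Function.Injective ι := by
    refine (ZMod.lift_injective _).2 fun k hk => ?_
    have hk : b ^ k = 1 := hk
    rwa [ZMod.intCast_zmod_eq_zero_iff_dvd, ← hb, orderOf_dvd_iff_zpow_eq_one]
  -- Points of `FreeExpAb n` give distinct characters of its dual `X`, which are linearly
  -- independent by Dedekind.
  let X := Multiplicative ((ℕ →₀ ZMod n) →+ ZMod n)
  let ev (p : FreeExpAb n) : X →* ℂ :=
    { toFun := fun χ => ZMod.stdAddChar (χ.toAdd p.toAdd)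
      map_one' := by simp
      map_mul' := fun χ χ' => AddChar.map_add_eq_mul _ _ _ }
  have hev : Function.Injective ev := fun p q hpq => by
    refine toAdd.injective (Finsupp.ext fun i => ?_)
    exact ZMod.injective_stdAddChar (DFunLike.congr_fun hpq (ofAdd (Finsupp.applyAddHom i)))
  have hlin := (linearIndependent_monoidHom X ℂ).comp ev hev
  rw [linearIndependent_iff'] at hlin
  have hsum : ∑ p ∈ d.support, (d p : ℂ) • (ev p : X → ℂ) = 0 := by
    ext χ
    -- `ι` embeds `ZMod n` in `B`, so the hypothesis applies to `χ` followed by `ι`.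
    have h1 : Finsupp.mapDomain (fun p : FreeExpAb n => χ.toAdd p.toAdd) d = 0 := by
      refine Finsupp.mapDomain_injective (f := fun z => (ι z).toMul)
        (fun _ _ hz => hι (Additive.toMul.injective hz)) ?_
      rw [← Finsupp.mapDomain_comp, Finsupp.mapDomain_zero]
      exact h (AddMonoidHom.toMultiplicativeLeft (ι.comp χ.toAdd))
    have h2 := Finsupp.sum_mapDomain_index (f := fun p : FreeExpAb n => χ.toAdd p.toAdd) (s := d)
      (h := fun z k => (k : ℂ) * ZMod.stdAddChar z) (by simp) (by simp [add_mul])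
    rw [h1, Finsupp.sum_zero_index] at h2
    simpa [Finsupp.sum, ev] using h2.symm
  ext p
  by_contra hp
  have := hlin d.support (fun p => (d p : ℂ)) hsum p (Finsupp.mem_support_iff.2 hp)
  exact hp (by simpa using this)

theorem exponent_dvd_magnus (h : Monoid.exponent A = 0 ∨ Monoid.exponent B = 0)
    {r : FreeGroup ℕ} (hr : IsGroupLaw (directWreath A B) r) (j : ℕ)
    (p : FreeExpAb (Monoid.exponent B)) :
    (Monoid.exponent A : ℤ) ∣ (magnus (FreeExpAb.gen (Monoid.exponent B)) r).left j p := by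
  have key := fun θ b => FoxPair.exponent_dvd_mapDomain
    (g := FreeExpAb.gen (Monoid.exponent B)) hr θ j b
  generalize (magnus (FreeExpAb.gen (Monoid.exponent B)) r).left j = d at key ⊢
  by_cases hB : Monoid.exponent B = 0
  -- With `n` a variable, `0` can be substituted for the exponent in the type of `d`.
  · have aux : ∀ n, n = 0 → ∀ (d : FreeExpAb n →₀ ℤ) (p : FreeExpAb n),
        (∀ (θ : FreeExpAb n →* B) (b : B),
          (Monoid.exponent A : ℤ) ∣ Finsupp.mapDomain θ d b) → (Monoid.exponent A : ℤ) ∣ d p := by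
      rintro _ rfl d p key
      exact dvd_of_mapDomain_of_exponent_eq_zero hB key p
    exact aux _ hB d p key
  -- Now `m = 0`, so divisibility by `m` means vanishing.
  · have hA := h.resolve_right hB
    obtain ⟨b, hb⟩ := Monoid.exists_orderOf_eq_exponent
      (Monoid.exponent_ne_zero.1 hB)
    have : d = 0 := eq_zero_of_mapDomain hB hb fun θ => Finsupp.ext fun b => by
      simpa [hA] using key θ b
    simp [this]

theorem IsGroupLaw.wreath_of_directWreath {N : Type w} {Q : Type*} [CommGroup N] [CommGroup Q]
    (h : Monoid.exponent A = 0 ∨ Monoid.exponent B = 0)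
    (hN : ∀ x : N, x ^ Monoid.exponent A = 1) (hQ : ∀ x : Q, x ^ Monoid.exponent B = 1)
    {r : FreeGroup ℕ} (hr : IsGroupLaw (directWreath A B) r) : IsGroupLaw (N ≀ᵣ Q) r := by
  intro φ
  obtain ⟨θ, hθ⟩ := FreeExpAb.exists_hom hQ fun i => (φ (FreeGroup.of i)).right
  rw [eq_toWreath_comp_magnus φ θ hθ, MonoidHom.comp_apply]
  refine RegularWreathProduct.ext (funext fun q => ?_) ?_
  · exact congrArg Additive.toMul (eval_eq_zero hN _ _ q (exponent_dvd_magnus h hr))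
  · have : (magnus (FreeExpAb.gen (Monoid.exponent B)) r).right = 1 := by
      rw [magnus_right]
      exact (isGroupLaw_of_directWreath hr).proj_eq_one
    simp [toWreath, this]

end Necessity

/-! ### Embedding extensions in wreath products -/

section KaloujnineKrasner

variable {H : Type u} [Group H] (N : Subgroup H) [N.Normal]

/-- The Kaloujnine–Krasner embedding of an extension into a wreath product. -/
noncomputable def kaloujnineKrasner : H →* N ≀ᵣ (H ⧸ N) where
  toFun x := ⟨fun q => ⟨q.out⁻¹ * x * ((x : H ⧸ N)⁻¹ * q).out, by
    rw [← QuotientGroup.eq_one_iff]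
    simp⟩, x⟩
  map_one' := by
    ext q <;> simp
  map_mul' x y := by
    ext q <;> simp [mul_assoc]

theorem kaloujnineKrasner_injective : Function.Injective (kaloujnineKrasner N) := by
  rw [injective_iff_map_eq_one]
  intro x hx
  have h1 : (x : H ⧸ N) = 1 := congrArg RegularWreathProduct.right hx
  have h2 := congrArg Subtype.val (congrFun (congrArg RegularWreathProduct.left hx) 1)
  simp only [kaloujnineKrasner, MonoidHom.coe_mk, OneHom.coe_mk, h1, inv_one, one_mul,
    RegularWreathProduct.one_left, Pi.one_apply, Subgroup.coe_one] at h2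
  -- The representative of the trivial coset need not be `1`, so `h2` only kills a conjugate of `x`.
  rw [← conj_eq_one_iff (a := (Quotient.out (1 : H ⧸ N))⁻¹), inv_inv]
  exact h2

end KaloujnineKrasner

theorem varietyProduct_subset_groupVar_directWreath {A : Type u} {B : Type v} [CommGroup A]
    [CommGroup B] (h : Monoid.exponent A = 0 ∨ Monoid.exponent B = 0) :
    varietyProduct (groupVar.{u, w} A) (groupVar.{v, w} B) ⊆
      groupVar.{max u v, w} (directWreath A B) := by
  rintro H ⟨N, hN, hNA, hQB⟩ r hr
  let : CommGroup N :=
    { (inferInstance : Group N) with mul_comm := mul_comm_of_mem_groupVar hNA }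
  let : CommGroup (H ⧸ N) :=
    { (inferInstance : Group (H ⧸ N)) with mul_comm := mul_comm_of_mem_groupVar hQB }
  exact (hr.wreath_of_directWreath (N := N) (Q := H ⧸ N) h (pow_eq_one_of_mem_groupVar hNA)
    (pow_eq_one_of_mem_groupVar hQB)).of_injective (kaloujnineKrasner N)
    (kaloujnineKrasner_injective N)

theorem mainTheorem8 (A : Type u) (B : Type v) [CommGroup A] [CommGroup B]
    (h : ¬ Monoid.ExponentExists A ∨ ¬ Monoid.ExponentExists B) :
    groupVar.{max u v, w} (A ≀ᵣ B) =
        varietyProduct (groupVar.{u, w} A) (groupVar.{v, w} B) ∧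
      groupVar.{max u v, w} (directWreath A B) =
        varietyProduct (groupVar.{u, w} A) (groupVar.{v, w} B) := by
  simp only [← Monoid.exponent_eq_zero_iff] at h
  have h1 := varietyProduct_subset_groupVar_directWreath.{u, v, w} h
  have h2 : groupVar.{max u v, w} (directWreath A B) ⊆ groupVar.{max u v, w} (A ≀ᵣ B) :=
    fun H hH r hr => hH r (hr.of_injective (directWreath A B).subtype Subtype.val_injective)
  have h3 := groupVar_wreath_subset.{u, v, w} (A := A) (B := B)
  exact ⟨h3.antisymm (h1.trans h2), (h2.trans h3).antisymm h1⟩
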